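/- Let $n\ge 1$ and let $C=(a_{ij})_{0\le i,j\le n}$ be the Cartan matrix of type $A_{2n}^{(2)}$, i.e. $\begin{pmatrix}2&-4\\-1&2\end{pmatrix}$ for $n=1$, and for $n\ge2$ the tridiagonal matrix with $2$ on the diagonal, $-1$ at all places $(i,i+1)$ and $(i+1,i)$ except $a_{01}=a_{n-1,n}=-2$. Let $(d_0,\dots,d_n)=(\tfrac12,1,\dots,1,2)$, so that $\mathrm{diag}(d_0,\dots,d_n)\,C$ is symmetric. Let $\mathfrak g$ be the affine Lie algebra over $\mathbb C$ of this type with generators $e_i,f_i$, coroots $h_i$ ($0\le i\le n$) and scaling element $d$. Weights are determined by their values on $h_0,\dots,h_n,d$; the simple roots satisfy $\langle h_i,\alpha_j\rangle=a_{ij}$, $\langle d,\alpha_j\rangle=\delta_{0j}$, and the fundamental weights satisfy $\langle h_i,\Lambda_j\rangle=\delta_{ij}$, $\langle d,\Lambda_j\rangle=0$. Let $(\cdot\mid\cdot)$ be the symmetric bilinear form on weights with $(\alpha_i\mid\mu)=d_i\langle h_i,\mu\rangle$ for all $i,\mu$ and $(\Lambda_0\mid\Lambda_0)=0$, and let $s_i(\mu)=\mu-\langle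 h_i,\mu\rangle\alpha_i$. Let $\Lambda=a_0\Lambda_0+\dots+a_n\Lambda_n$ with $a_j\in\mathbb Z_{\ge0}$, let $V(\Lambda)$ be the irreducible highest weight $\mathfrak g$-module with highest weight $\Lambda$, and let $P(\Lambda)$ be its set of weights. For a weight $\lambda$ put $\mathrm{defect}(\lambda)=\tfrac12\big((\Lambda\mid\Lambda)-(\lambda\mid\lambda)\big)$, and call $\theta_i(\lambda)=\langle h_i,\lambda\rangle$ the $i$-th hub component of $\lambda$. Two elements of $P(\Lambda)$ are joined by an edge of residue $i$ if they differ by $\pm\alpha_i$; an $i$-string is a maximal subset of $P(\Lambda)$ connected by edges of residue $i$. Fix $i\in\{0,\dots,n\}$. **Lemma.** Let $\alpha\in Q_+=\sum_j\mathbb Z_{\ge0}\alpha_j$ be such that $\eta=\Lambda-\alpha\in P(\Lambda)$ and $w=\theta_i(\eta)\ge0$. Then $w$ is an integer, the weights $\eta,\eta-\alpha_i,\dots,\eta-w\alpha_i$ all belong to $P(\Lambda)$ and lie on one $i$-string, and $s_i(\eta)=\eta-w\alpha_i$. Moreover: 1. $\mathrm{defect}(\eta-k\alpha_i)=\mathrm{defect}(\eta)+d_i\,k(w-k)$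 for $0\le k\le w$. 2. $\theta_i(\eta-k\alpha_i)=w-2k$ for $0\le k\le w$. Consequently, if $0\le k<l\le w/2$, then passing from $\eta-k\alpha_i$ to $\eta-l\alpha_i$ strictly increases the defect and strictly decreases $|\theta_i|$; if $w/2\le k<l\le w$, it strictly decreases the defect and strictly increases $|\theta_i|$. **Corollary.** For $0\le k\le a_i$, the weight $\Lambda-k\alpha_i$ lies in $P(\Lambda)$ and $\mathrm{defect}(\Lambda-k\alpha_i)=d_i\,k(a_i-k)$. -/

import Mathlib

namespace TwistedAffine

/-! ### Cartan data of type `A_{2n}^{(2)}` (`n ≥ 1`), nodes `0, 1, …, n` -/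

/-- The Cartan matrix of type `A_{2n}^{(2)}`; the entry `(i, j)` is `⟨h_i, α_j⟩`.
For `n = 1` it is `[[2, -4], [-1, 2]]`. -/
def cartan (n : ℕ) : Matrix (Fin (n + 1)) (Fin (n + 1)) ℤ := fun i j =>
  if i = j then 2
  else if i.val + 1 = j.val then
    (if n = 1 then -4 else if i.val = 0 ∨ j.val = n then -2 else -1)
  else if j.val + 1 = i.val then -1
  else 0

/-- The diagonal entries `d_i` of the symmetrizing matrix `diag(1/2, 1, …, 1, 2)`. -/
noncomputable def symmetrizer (n : ℕ) (i : Fin (n + 1)) : ℝ :=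
  if i.val = 0 then 1 / 2 else if i.val = n then 2 else 1

/-! ### The affine Lie algebra -/

/-- Generators: Chevalley generators `e i`, `f i`, the coroots `h i`, and the scaling element `d`. -/
inductive Gen (n : ℕ) : Type
  | e : Fin (n + 1) → Gen n
  | f : Fin (n + 1) → Gen n
  | h : Fin (n + 1) → Gen n
  | d : Gen n

/-- A generator as an element of the free Lie algebra over `ℂ`. -/
noncomputable def gen {n : ℕ} (x : Gen n) : FreeLieAlgebra ℂ (Gen n) := FreeLieAlgebra.of ℂ x

/-- The defining relators, including the Serre relators, of the affine algebra `A_{2n}^{(2)}`. -/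
inductive Relator (n : ℕ) : FreeLieAlgebra ℂ (Gen n) → Prop
  | hh (i j : Fin (n + 1)) : Relator n ⁅gen (n := n) (.h i), gen (n := n) (.h j)⁆
  | dh (i : Fin (n + 1)) : Relator n ⁅gen (n := n) .d, gen (n := n) (.h i)⁆
  | ef_same (i : Fin (n + 1)) : Relator n (⁅gen (n := n) (.e i), gen (n := n) (.f i)⁆ - gen (n := n) (.h i))
  | ef_ne (i j : Fin (n + 1)) (hij : i ≠ j) : Relator n ⁅gen (n := n) (.e i), gen (n := n) (.f j)⁆
  | he (i j : Fin (n + 1)) :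
      Relator n (⁅gen (n := n) (.h i), gen (n := n) (.e j)⁆ - (cartan n i j : ℂ) • gen (n := n) (.e j))
  | hf (i j : Fin (n + 1)) :
      Relator n (⁅gen (n := n) (.h i), gen (n := n) (.f j)⁆ + (cartan n i j : ℂ) • gen (n := n) (.f j))
  | de (j : Fin (n + 1)) :
      Relator n (⁅gen (n := n) .d, gen (n := n) (.e j)⁆ - (if j = 0 then (1 : ℂ) else 0) • gen (n := n) (.e j))
  | df (j : Fin (n + 1)) :
      Relator n (⁅gen (n := n) .d, gen (n := n) (.f j)⁆ + (if j = 0 then (1 : ℂ) else 0) • gen (n := n) (.f j))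
  | serre_e (i j : Fin (n + 1)) (hij : i ≠ j) :
      Relator n (((LieAlgebra.ad ℂ (FreeLieAlgebra ℂ (Gen n)) (gen (n := n) (.e i))) ^
        (1 - cartan n i j).toNat) (gen (n := n) (.e j)))
  | serre_f (i j : Fin (n + 1)) (hij : i ≠ j) :
      Relator n (((LieAlgebra.ad ℂ (FreeLieAlgebra ℂ (Gen n)) (gen (n := n) (.f i))) ^
        (1 - cartan n i j).toNat) (gen (n := n) (.f j)))

/-- The Lie ideal generated by the relators. -/
noncomputable def relatorIdeal (n : ℕ) : LieIdeal ℂ (FreeLieAlgebra ℂ (Gen n)) :=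
  LieSubmodule.lieSpan ℂ (FreeLieAlgebra ℂ (Gen n)) {x | Relator n x}

/-- The affine Lie algebra `𝔤` of type `A_{2n}^{(2)}`, with its scaling element. -/
abbrev Algebra (n : ℕ) : Type := FreeLieAlgebra ℂ (Gen n) ⧸ relatorIdeal n

/-- A generator as an element of `𝔤`. -/
noncomputable def toAlgebra {n : ℕ} (x : Gen n) : Algebra n :=
  LieSubmodule.Quotient.mk (N := relatorIdeal n) (gen x)

/-! ### Weights -/

/-- The real weight space: a weight `μ` is given by its values on the basis `h_0, …, h_n, d` of the
Cartan subalgebra, `μ.1 i = ⟨h_i, μ⟩` and `μ.2 = ⟨d, μ⟩`. -/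
abbrev Weight (n : ℕ) : Type := (Fin (n + 1) → ℝ) × ℝ

/-- The component `θ_i = ⟨h_i, μ⟩` of the hub of `μ`. -/
def hub {n : ℕ} (μ : Weight n) (i : Fin (n + 1)) : ℝ := μ.1 i

/-- The simple root `α_j`: `⟨h_i, α_j⟩ = a_{ij}`, `⟨d, α_0⟩ = 1` and `⟨d, α_j⟩ = 0` for `j ≠ 0`. -/
noncomputable def simpleRoot {n : ℕ} (j : Fin (n + 1)) : Weight n :=
  (fun i => (cartan n i j : ℝ), if j = 0 then 1 else 0)

/-- The fundamental weight `Λ_j`: `⟨h_i, Λ_j⟩ = δ_{ij}` and `⟨d, Λ_j⟩ = 0`. -/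
noncomputable def fundamentalWeight {n : ℕ} (j : Fin (n + 1)) : Weight n :=
  (Pi.single j 1, 0)

/-- The dominant integral weight `a_0 Λ_0 + ⋯ + a_n Λ_n`. -/
noncomputable def dominantWeight {n : ℕ} (a : Fin (n + 1) → ℕ) : Weight n :=
  ∑ j, (a j : ℝ) • fundamentalWeight j

/-- `Q_+`, the sums of simple roots with nonnegative integer coefficients. -/
def QPlus (n : ℕ) : Set (Weight n) :=
  {α | ∃ c : Fin (n + 1) → ℕ, α = ∑ j, (c j : ℝ) • simpleRoot j}

/-- The simple reflection `s_i(μ) = μ - ⟨h_i, μ⟩ α_i`. -/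
noncomputable def reflection {n : ℕ} (i : Fin (n + 1)) (μ : Weight n) : Weight n :=
  μ - hub μ i • simpleRoot i

/-- The level `⟨c, μ⟩` of a weight, where `c = h_0 + 2 (h_1 + ⋯ + h_n)`. -/
noncomputable def level {n : ℕ} (μ : Weight n) : ℝ :=
  ∑ i : Fin (n + 1), (if i = 0 then 1 else 2) * hub μ i

/-- The normalized invariant form on the weight space, written in the coordinates dual to
`h_0, …, h_n, d`. It is the symmetric bilinear form with `(α_i | μ) = d_i ⟨h_i, μ⟩` for all `i` and
`μ` and `(Λ_0 | Λ_0) = 0` (see `form_simpleRoot`, `form_fundamentalWeight_zero`), and these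
properties determine it because `Λ_0, α_0, …, α_n` is a basis. -/
noncomputable def form {n : ℕ} (μ ν : Weight n) : ℝ :=
  (∑ i : Fin (n + 1), ∑ j : Fin (n + 1), ((min i.val j.val : ℕ) : ℝ) * hub μ i * hub ν j)
    + (level μ * ν.2 + level ν * μ.2) / 2

/-- The defect of `μ` relative to the highest weight `Λ`: `((Λ | Λ) - (μ | μ)) / 2`. -/
noncomputable def defect {n : ℕ} (Λ μ : Weight n) : ℝ := (form Λ Λ - form μ μ) / 2

/-! ### Highest weight modules, their weights, and strings -/

section Modules

variable {n : ℕ} (V : Type*) [AddCommGroup V] [Module ℂ V]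
  [LieRingModule (Algebra n) V] [LieModule ℂ (Algebra n) V]

/-- The weight space `V_μ`. -/
noncomputable def weightSpace (μ : Weight n) : Submodule ℂ V :=
  (⨅ i : Fin (n + 1), Module.End.eigenspace
      (LieModule.toEnd ℂ (Algebra n) V (toAlgebra (.h i))) ((μ.1 i : ℝ) : ℂ)) ⊓
    Module.End.eigenspace (LieModule.toEnd ℂ (Algebra n) V (toAlgebra .d)) ((μ.2 : ℝ) : ℂ)

/-- The set of weights of `V`; for `V = V(Λ)` this is `P(Λ)`. -/
def weights : Set (Weight n) := {μ | weightSpace V μ ≠ ⊥}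

/-- `V` is the irreducible highest weight module `V(Λ)`: it is irreducible and has a nonzero vector
of weight `Λ` killed by every `e_i` (which then generates `V`). -/
structure IsIrreducibleHighestWeight (Λ : Weight n) : Prop where
  irreducible : LieModule.IsIrreducible ℂ (Algebra n) V
  exists_highest : ∃ v : V, v ≠ 0 ∧ v ∈ weightSpace V Λ ∧
    ∀ i : Fin (n + 1), ⁅(toAlgebra (.e i) : Algebra n), v⁆ = 0

/-- The edges of residue `i` of the block-reduced crystal, whose vertices are the weights of `V`. -/
def residueGraph (i : Fin (n + 1)) : SimpleGraph (weights (n := n) V) :=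
  SimpleGraph.fromRel fun μ ν => (μ : Weight n) - (ν : Weight n) = simpleRoot i

/-- An `i`-string: a maximal set of vertices connected by edges of residue `i`. -/
def IsString (i : Fin (n + 1)) (S : Set (Weight n)) : Prop :=
  ∃ C : (residueGraph (n := n) V i).ConnectedComponent, S = Subtype.val '' C.supp

end Modules

/-! ### The form is the normalized invariant form -/

theorem form_comm {n : ℕ} (μ ν : Weight n) : form μ ν = form ν μ := by
  unfold form
  rw [Finset.sum_comm, add_comm (level μ * ν.2)]
  simp only [min_comm, mul_right_comm]

theorem form_fundamentalWeight_zero {n : ℕ} :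
    form (fundamentalWeight (0 : Fin (n + 1))) (fundamentalWeight 0) = 0 := by
  simp [form, fundamentalWeight, hub, Pi.single_apply]

theorem sum_cartan {n : ℕ} (g : ℕ → ℝ) (i : Fin (n + 1)) :
    ∑ j : Fin (n + 1), g j.val * (cartan n j i : ℝ) =
      2 * g i.val + (if i.val < n then -g (i.val + 1) else 0) +
      (if i.val = 0 then 0 else
        g (i.val - 1) * (if n = 1 then -4 else if i.val = 1 ∨ i.val = n then -2 else -1)) := by
  obtain ⟨m, hm⟩ := i
  have key : ∀ j : Fin (n + 1), g j.val * (cartan n j ⟨m, hm⟩ : ℝ) =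
      (fun j : ℕ => (if j = m then 2 * g m else 0) + (if j = m + 1 then -g (m + 1) else 0) +
        (if m = 0 then 0 else if j = m - 1 then
          g (m - 1) * (if n = 1 then -4 else if m = 1 ∨ m = n then -2 else -1) else 0)) j.val := by
    rintro ⟨j, hj⟩
    simp only [cartan, Fin.mk.injEq]
    rcases lt_trichotomy j m with h | h | h
    · obtain ⟨k, rfl⟩ : ∃ k, m = k + 1 := ⟨m - 1, by omega⟩
      by_cases hk : j = k
      · subst hk
        have h4 : ¬ (j = j + 1 + 1) := by omega
        have h5 : ¬ (j = j + 1) := by omega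
        have h6 : j + 1 = 1 ↔ j = 0 := by omega
        simp only [if_neg h4, if_neg h5, h6, Nat.add_sub_cancel, if_true, Nat.succ_ne_zero,
          if_false, zero_add]
        split_ifs <;> simp
      · have h1 : j ≠ k + 1 := by omega
        have h2 : j ≠ k + 1 + 1 := by omega
        have h3 : k + 1 + 1 ≠ j := by omega
        simp [hk, h1, h2, h3]
    · subst h
      have h2 : j ≠ 0 → j ≠ j - 1 := by omega
      by_cases h3 : j = 0
      · simp [h3, mul_comm]
      · simp [h3, h2 h3, mul_comm]
    · by_cases hk : j = m + 1
      · subst hk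
        have h2 : ¬ (m + 1 = m - 1) := by omega
        have h3 : ¬ (m + 1 + 1 = m) := by omega
        simp [h2, h3]
      · have h1 : j ≠ m := by omega
        have h2 : j ≠ m - 1 := by omega
        have h3 : m + 1 ≠ j := by omega
        have h4 : j + 1 ≠ m := by omega
        simp [hk, h1, h2, h3, h4]
  rw [Finset.sum_congr rfl (fun j _ => key j), Fin.sum_univ_eq_sum_range (fun j : ℕ =>
      (if j = m then 2 * g m else 0) + (if j = m + 1 then -g (m + 1) else 0) +
        (if m = 0 then 0 else if j = m - 1 then
          g (m - 1) * (if n = 1 then -4 else if m = 1 ∨ m = n then -2 else -1) else 0)),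
    Finset.sum_add_distrib, Finset.sum_add_distrib]
  have e3 : m - 1 < n + 1 := by omega
  by_cases h0 : m = 0 <;> simp [h0, hm, e3]

theorem form_simpleRoot {n : ℕ} (hn : 1 ≤ n) (i : Fin (n + 1)) (μ : Weight n) :
    form (simpleRoot i) μ = symmetrizer n i * hub μ i := by
  have hl : level (simpleRoot i : Weight n) = 0 := by
    have h := sum_cartan (n := n) (fun j => if j = 0 then 1 else 2) i
    have h' : level (simpleRoot i : Weight n) =
        ∑ j : Fin (n + 1), (fun j : ℕ => if j = 0 then (1 : ℝ) else 2) j.val *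
          (cartan n j i : ℝ) := by
      refine Finset.sum_congr rfl fun j _ => ?_
      have : (j.val = 0) ↔ j = 0 := by rw [Fin.ext_iff]; rfl
      simp only [this, hub, simpleRoot]
    rw [h', h]
    have hi := i.isLt
    generalize i.val = m at hi
    obtain rfl | rfl | hm : m = 0 ∨ m = 1 ∨ 2 ≤ m := by omega
    · have : 0 < n := hn
      simp [this]
    · by_cases h1 : n = 1
      · simp [h1]; norm_num
      · have : 1 < n := by omega
        simp [h1, this]; norm_num
    · have h0 : m ≠ 0 := by omega
      have h1 : m ≠ 1 := by omega
      have h2 : m - 1 ≠ 0 := by omega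
      have h3 : n ≠ 1 := by omega
      by_cases h4 : m = n
      · subst h4; simp [h0, h1, h2]; try norm_num
      · have : m < n := by omega
        simp [h0, h1, h2, h3, h4, this]; norm_num
  have hk : ∀ k : Fin (n + 1),
      ∑ j : Fin (n + 1), ((min j.val k.val : ℕ) : ℝ) * (cartan n j i : ℝ) =
        (if k = i then symmetrizer n i else 0) -
          (if i = 0 then (if k = 0 then 1 else 2) / 2 else 0) := by
    intro k
    have h := sum_cartan (n := n) (fun j => ((min j k.val : ℕ) : ℝ)) i
    rw [h]
    simp only [Fin.ext_iff, symmetrizer, Fin.val_zero]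
    have hi := i.isLt
    have hk := k.isLt
    generalize i.val = m at hi
    generalize k.val = l at hk
    obtain rfl | hm : m = 0 ∨ 1 ≤ m := by omega
    · obtain rfl | hl : l = 0 ∨ 1 ≤ l := by omega
      · simp
      · have h1 : min 1 l = 1 := by omega
        have h2 : l ≠ 0 := by omega
        have h3 : 0 < n := hn
        simp [h1, h2, h3]
    · obtain ⟨p, rfl⟩ : ∃ p, m = p + 1 := ⟨m - 1, by omega⟩
      obtain hl | rfl | hl : l ≤ p ∨ l = p + 1 ∨ p + 2 ≤ l := by omega
      · have h1 : min (p + 1) l = l := by omega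
        have h2 : min (p + 2) l = l := by omega
        have h3 : min p l = l := by omega
        have h4 : l ≠ p + 1 := by omega
        have h6 : p = 0 → l = 0 := by omega
        by_cases h5 : n = 1
        · have hp : p = 0 := by omega
          have := h6 hp
          simp [h5, hp, this]
        · by_cases h7 : p = 0
          · simp [h7, h6 h7]
          · by_cases h8 : p + 1 = n
            · subst h8
              simp [h1, h3, h4, h7]; ring
            · have h9 : p + 1 < n := by omega
              simp [h1, h2, h3, h4, h5, h7, h8, h9]; ring
      · by_cases h5 : n = 1
        · have hp : p = 0 := by omega
          simp [h5, hp]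
        · by_cases h8 : p + 1 = n
          · subst h8
            have h7 : p ≠ 0 := by omega
            simp [h7]; ring
          · have h9 : p + 1 < n := by omega
            by_cases h7 : p = 0
            · have : 1 < n := by omega
              have h10 : ¬ (1 = n) := by omega
              simp [h7, h5, this, h10]; norm_num
            · simp [h5, h7, h8, h9]; ring
      · have h1 : min (p + 1) l = p + 1 := by omega
        have h2 : min (p + 2) l = p + 2 := by omega
        have h3 : min p l = p := by omega
        have h4 : l ≠ p + 1 := by omega
        have h5 : n ≠ 1 := by omega
        have h8 : p + 1 ≠ n := by omega
        have h9 : p + 1 < n := by omega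
        by_cases h7 : p = 0
        · subst h7
          simp [h1, h2, h4, h5, h8, h9]; try norm_num
        · simp [h1, h2, h3, h4, h5, h7, h8, h9]; ring
  have hs : (∑ j : Fin (n + 1), ∑ k : Fin (n + 1),
      ((min j.val k.val : ℕ) : ℝ) * hub (simpleRoot i : Weight n) j * hub μ k) =
      symmetrizer n i * hub μ i - (if i = 0 then level μ / 2 else 0) := by
    rw [Finset.sum_comm]
    have : ∀ k : Fin (n + 1), (∑ j : Fin (n + 1),
        ((min j.val k.val : ℕ) : ℝ) * hub (simpleRoot i : Weight n) j * hub μ k) =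
        (if k = i then symmetrizer n i * hub μ k else 0) -
          (if i = 0 then ((if k = 0 then 1 else 2) * hub μ k) / 2 else 0) := by
      intro k
      rw [← Finset.sum_mul]
      simp only [hub, simpleRoot]
      rw [hk k]
      split_ifs <;> ring
    rw [Finset.sum_congr rfl (fun k _ => this k), Finset.sum_sub_distrib]
    congr 1
    · simp
    · split_ifs
      · rw [level, Finset.sum_div]
      · simp
  rw [form, hs, hl]
  simp only [simpleRoot]
  split_ifs <;> ring

end TwistedAffine

/-!
The string property comes from the representation theory of the `sl₂`-triple `(h_i, e_i, f_i)`.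

The operator `e_i` is locally nilpotent on `V(Λ)`. By the Serre and the other defining relations
`ad e_i` is nilpotent on each generator, so the vectors killed by some power of `e_i` form a
submodule (`lieNilpotentSubmodule`). It contains the highest weight vector, hence is everything by
irreducibility (`exists_pow_e_eq_zero`).

Now let `v ≠ 0` have weight `η` with `w = ⟨h_i, η⟩ ≥ 0`. Let `u = e_i ^ j v` be the last nonzero
vector among the `e_i`-translates of `v`. It is primitive of `h_i`-weight `w + 2j`, so that
`f_i ^ m u ≠ 0` for all `m ≤ w + 2j`. With `m = j + k` this yields a nonzero vector of weight
`η - k α_i` for every `k ≤ w` (`sub_smul_simpleRoot_mem_weights`). Starting at the top of the string,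
rather than applying `f_i` to `v` itself, makes the local nilpotency of `f_i` unnecessary.

The formulas for the defect and the hub follow by bilinearity from `(α_i | μ) = d_i ⟨h_i, μ⟩` and
`⟨h_i, α_i⟩ = 2`; the monotonicity statements then concern the quadratic `k (w - k)`.
-/

namespace TwistedAffine

variable {n : ℕ}

/-! ### Relations in the affine Lie algebra -/

theorem toAlgebra_lie (x y : Gen n) :
    ⁅(toAlgebra x : Algebra n), (toAlgebra y : Algebra n)⁆ =
      LieSubmodule.Quotient.mk (N := relatorIdeal n) ⁅gen x, gen y⁆ :=
  (LieSubmodule.Quotient.mk_bracket _ _ _).symm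

theorem mk_eq_zero_of_relator {x : FreeLieAlgebra ℂ (Gen n)} (hx : Relator n x) :
    (LieSubmodule.Quotient.mk x : Algebra n) = 0 :=
  LieSubmodule.Quotient.mk_eq_zero'.2 (LieSubmodule.subset_lieSpan hx)

theorem lie_e_f_same (i : Fin (n + 1)) :
    ⁅(toAlgebra (.e i) : Algebra n), (toAlgebra (.f i) : Algebra n)⁆ = toAlgebra (.h i) :=
  (toAlgebra_lie _ _).trans (sub_eq_zero.1 (mk_eq_zero_of_relator (.ef_same i)))

theorem lie_e_f_ne {i j : Fin (n + 1)} (hij : i ≠ j) :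
    ⁅(toAlgebra (.e i) : Algebra n), (toAlgebra (.f j) : Algebra n)⁆ = 0 :=
  (toAlgebra_lie _ _).trans (mk_eq_zero_of_relator (.ef_ne i j hij))

theorem lie_h_e (i j : Fin (n + 1)) :
    ⁅(toAlgebra (.h i) : Algebra n), (toAlgebra (.e j) : Algebra n)⁆ =
      (cartan n i j : ℂ) • (toAlgebra (.e j) : Algebra n) :=
  (toAlgebra_lie _ _).trans (sub_eq_zero.1 (mk_eq_zero_of_relator (.he i j)))

theorem lie_h_f (i j : Fin (n + 1)) :
    ⁅(toAlgebra (.h i) : Algebra n), (toAlgebra (.f j) : Algebra n)⁆ =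
      -((cartan n i j : ℂ) • (toAlgebra (.f j) : Algebra n)) :=
  (toAlgebra_lie _ _).trans (eq_neg_of_add_eq_zero_left (mk_eq_zero_of_relator (.hf i j)))

theorem lie_d_e (j : Fin (n + 1)) :
    ⁅(toAlgebra .d : Algebra n), (toAlgebra (.e j) : Algebra n)⁆ =
      (if j = 0 then (1 : ℂ) else 0) • (toAlgebra (.e j) : Algebra n) :=
  (toAlgebra_lie _ _).trans (sub_eq_zero.1 (mk_eq_zero_of_relator (.de j)))

theorem lie_d_f (j : Fin (n + 1)) :
    ⁅(toAlgebra .d : Algebra n), (toAlgebra (.f j) : Algebra n)⁆ =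
      -((if j = 0 then (1 : ℂ) else 0) • (toAlgebra (.f j) : Algebra n)) :=
  (toAlgebra_lie _ _).trans (eq_neg_of_add_eq_zero_left (mk_eq_zero_of_relator (.df j)))

theorem ad_pow_e_e {i j : Fin (n + 1)} (hij : i ≠ j) :
    ((LieAlgebra.ad ℂ (Algebra n) (toAlgebra (.e i))) ^ (1 - cartan n i j).toNat)
      (toAlgebra (.e j)) = 0 := by
  have key : ∀ (k : ℕ) (y : FreeLieAlgebra ℂ (Gen n)),
      ((LieAlgebra.ad ℂ (Algebra n) (toAlgebra (.e i))) ^ k) (LieSubmodule.Quotient.mk y) =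
        (LieSubmodule.Quotient.mk
          (((LieAlgebra.ad ℂ (FreeLieAlgebra ℂ (Gen n)) (gen (.e i))) ^ k) y) : Algebra n) := by
    intro k
    induction k with
    | zero => intro y; rfl
    | succ k ih =>
      intro y
      rw [pow_succ, pow_succ, Module.End.mul_apply, Module.End.mul_apply, ← ih]
      rfl
  exact (key _ _).trans (mk_eq_zero_of_relator (.serre_e i j hij))

theorem cartan_self (i : Fin (n + 1)) : cartan n i i = 2 := if_pos rfl

theorem isSl2Triple {i : Fin (n + 1)} (h0 : (toAlgebra (.h i) : Algebra n) ≠ 0) :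
    IsSl2Triple (toAlgebra (.h i) : Algebra n) (toAlgebra (.e i)) (toAlgebra (.f i)) where
  h_ne_zero := h0
  lie_e_f := lie_e_f_same i
  lie_h_e_nsmul := by
    rw [lie_h_e, cartan_self, Int.cast_ofNat, ofNat_smul_eq_nsmul ℂ 2]
  lie_h_f_nsmul := by
    rw [lie_h_f, cartan_self, Int.cast_ofNat, ofNat_smul_eq_nsmul ℂ 2]

/-- The generators generate the affine Lie algebra. -/
theorem eq_top_of_toAlgebra_mem (K : LieSubalgebra ℂ (Algebra n))
    (hK : ∀ x : Gen n, toAlgebra x ∈ K) : K = ⊤ := by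
  let F : FreeLieAlgebra ℂ (Gen n) →ₗ⁅ℂ⁆ K := FreeLieAlgebra.lift ℂ fun x => ⟨toAlgebra x, hK x⟩
  let π : FreeLieAlgebra ℂ (Gen n) →ₗ⁅ℂ⁆ Algebra n :=
    { LieSubmodule.Quotient.mk' (relatorIdeal n) with
      map_lie' := fun {x y} => LieSubmodule.Quotient.mk_bracket _ x y }
  have hF : K.incl.comp F = π := by
    refine FreeLieAlgebra.hom_ext fun x => ?_
    simp only [F, LieHom.comp_apply, FreeLieAlgebra.lift_of_apply]
    rfl
  refine eq_top_iff.2 fun x _ => ?_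
  obtain ⟨y, rfl⟩ := LieSubmodule.Quotient.surjective_mk' (relatorIdeal n) x
  have : π y ∈ K := by
    rw [← hF]
    exact (F y).2
  exact this

/-! ### Local nilpotency of the raising operators -/

/-- `ad e_i` is nilpotent on each generator, at most to order three except on the generators `e_j`,
where the Serre relations give the order. -/
theorem toAlgebra_mem_maxGenEigenspace (i : Fin (n + 1)) (x : Gen n) :
    (toAlgebra x : Algebra n) ∈
      (LieModule.toEnd ℂ (Algebra n) (Algebra n) (toAlgebra (.e i))).maxGenEigenspace 0 := by
  have hh : ∀ j, ⁅(toAlgebra (.e i) : Algebra n), ⁅(toAlgebra (.e i) : Algebra n),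
      (toAlgebra (.h j) : Algebra n)⁆⁆ = 0 := by
    intro j
    rw [← lie_skew _ (toAlgebra (.h j) : Algebra n), lie_h_e, lie_neg, lie_smul, lie_self,
      smul_zero, neg_zero]
  rw [Module.End.mem_maxGenEigenspace, zero_smul, sub_zero]
  cases x with
  | e j =>
    by_cases hij : i = j
    · subst hij
      exact ⟨1, by simp⟩
    · exact ⟨_, ad_pow_e_e hij⟩
  | f j =>
    by_cases hij : i = j
    · subst hij
      refine ⟨3, ?_⟩
      simp only [pow_succ, pow_zero, one_mul, Module.End.mul_apply, LieModule.toEnd_apply_apply,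
        lie_e_f_same, hh]
    · exact ⟨1, by simp [lie_e_f_ne hij]⟩
  | h j =>
    refine ⟨2, ?_⟩
    simp only [pow_succ, pow_zero, one_mul, Module.End.mul_apply, LieModule.toEnd_apply_apply, hh]
  | d =>
    refine ⟨2, ?_⟩
    simp only [pow_succ, pow_zero, one_mul, Module.End.mul_apply, LieModule.toEnd_apply_apply]
    rw [← lie_skew _ (toAlgebra .d : Algebra n), lie_d_e, lie_neg, lie_smul, lie_self,
      smul_zero, neg_zero]

section Modules

variable (V : Type*) [AddCommGroup V] [Module ℂ V]
  [LieRingModule (Algebra n) V] [LieModule ℂ (Algebra n) V]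

/-- The vectors killed by some power of `e_i`. -/
noncomputable def lieNilpotentSubmodule (i : Fin (n + 1)) : LieSubmodule ℂ (Algebra n) V where
  __ := (LieModule.toEnd ℂ (Algebra n) V (toAlgebra (.e i))).maxGenEigenspace 0
  lie_mem {x m} hm := by
    let W := (LieModule.toEnd ℂ (Algebra n) V (toAlgebra (.e i))).maxGenEigenspace 0
    -- The elements of the Lie algebra that stabilize `W` form a subalgebra.
    let K : LieSubalgebra ℂ (Algebra n) :=
      { carrier := {x | ∀ m ∈ W, ⁅x, m⁆ ∈ W}
        add_mem' := fun {x y} hx hy m hm => by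
          rw [add_lie]
          exact W.add_mem (hx m hm) (hy m hm)
        zero_mem' := fun m _ => by
          rw [zero_lie]
          exact W.zero_mem
        smul_mem' := fun c x hx m hm => by
          rw [smul_lie]
          exact W.smul_mem c (hx m hm)
        lie_mem' := fun {x y} hx hy m hm => by
          rw [lie_lie]
          exact W.sub_mem (hx _ (hy m hm)) (hy _ (hx m hm)) }
    have hK : K = ⊤ := eq_top_of_toAlgebra_mem K fun y m hm => by
      simpa only [add_zero] using LieModule.lie_mem_maxGenEigenspace_toEnd
        (toAlgebra_mem_maxGenEigenspace i y) hm
    have hx : x ∈ K := hK ▸ LieSubalgebra.mem_top x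
    exact hx m hm

variable {V}

theorem exists_pow_e_eq_zero {Λ : Weight n} (hV : IsIrreducibleHighestWeight V Λ)
    (i : Fin (n + 1)) (v : V) :
    ∃ N : ℕ, (LieModule.toEnd ℂ (Algebra n) V (toAlgebra (.e i)) ^ N) v = 0 := by
  have hirr := hV.irreducible
  obtain ⟨u, hu0, -, hu⟩ := hV.exists_highest
  have hmem : u ∈ lieNilpotentSubmodule V i := by
    refine (Module.End.mem_maxGenEigenspace _ _ _).2 ⟨1, ?_⟩
    simp [hu i]
  have htop : lieNilpotentSubmodule V i = ⊤ := by
    refine (IsSimpleOrder.eq_bot_or_eq_top _).resolve_left fun hbot => hu0 ?_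
    rwa [hbot, LieSubmodule.mem_bot] at hmem
  have hv : v ∈ lieNilpotentSubmodule V i := htop ▸ LieSubmodule.mem_top v
  simpa using (Module.End.mem_maxGenEigenspace _ _ _).1 hv

/-! ### Weight strings -/

theorem mem_weightSpace {μ : Weight n} {v : V} :
    v ∈ weightSpace V μ ↔
      (∀ j, ⁅(toAlgebra (.h j) : Algebra n), v⁆ = ((μ.1 j : ℝ) : ℂ) • v) ∧
        ⁅(toAlgebra .d : Algebra n), v⁆ = ((μ.2 : ℝ) : ℂ) • v := by
  simp [weightSpace, Submodule.mem_iInf]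

theorem lie_e_mem_weightSpace {μ : Weight n} {v : V} (i : Fin (n + 1)) (hv : v ∈ weightSpace V μ) :
    ⁅(toAlgebra (.e i) : Algebra n), v⁆ ∈ weightSpace V (μ + simpleRoot i) := by
  rw [mem_weightSpace] at hv ⊢
  refine ⟨fun j => ?_, ?_⟩
  · rw [leibniz_lie, lie_h_e, hv.1, smul_lie, lie_smul, ← add_smul]
    simp [simpleRoot, add_comm]
  · rw [leibniz_lie, lie_d_e, hv.2, smul_lie, lie_smul, ← add_smul]
    by_cases h : i = 0 <;> simp [simpleRoot, add_comm, h]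

theorem lie_f_mem_weightSpace {μ : Weight n} {v : V} (i : Fin (n + 1)) (hv : v ∈ weightSpace V μ) :
    ⁅(toAlgebra (.f i) : Algebra n), v⁆ ∈ weightSpace V (μ - simpleRoot i) := by
  rw [mem_weightSpace] at hv ⊢
  refine ⟨fun j => ?_, ?_⟩
  · rw [leibniz_lie, lie_h_f, hv.1, neg_lie, smul_lie, lie_smul, ← neg_smul, ← add_smul]
    simp [simpleRoot, sub_eq_neg_add]
  · rw [leibniz_lie, lie_d_f, hv.2, neg_lie, smul_lie, lie_smul, ← neg_smul, ← add_smul]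
    by_cases h : i = 0 <;> simp [simpleRoot, sub_eq_neg_add, h]

theorem pow_e_mem_weightSpace {μ : Weight n} {v : V} (i : Fin (n + 1)) (hv : v ∈ weightSpace V μ)
    (k : ℕ) : (LieModule.toEnd ℂ (Algebra n) V (toAlgebra (.e i)) ^ k) v ∈
      weightSpace V (μ + (k : ℝ) • simpleRoot i) := by
  induction k with
  | zero => simpa using hv
  | succ k ih =>
    rw [pow_succ', Module.End.mul_apply, LieModule.toEnd_apply_apply, Nat.cast_succ, add_smul,
      one_smul, ← add_assoc]
    exact lie_e_mem_weightSpace i ih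

theorem pow_f_mem_weightSpace {μ : Weight n} {v : V} (i : Fin (n + 1)) (hv : v ∈ weightSpace V μ)
    (k : ℕ) : (LieModule.toEnd ℂ (Algebra n) V (toAlgebra (.f i)) ^ k) v ∈
      weightSpace V (μ - (k : ℝ) • simpleRoot i) := by
  induction k with
  | zero => simpa using hv
  | succ k ih =>
    rw [pow_succ', Module.End.mul_apply, LieModule.toEnd_apply_apply, Nat.cast_succ, add_smul,
      one_smul, ← sub_sub]
    exact lie_f_mem_weightSpace i ih

theorem sub_smul_simpleRoot_mem_weights {Λ : Weight n} (hV : IsIrreducibleHighestWeight V Λ)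
    {η : Weight n} (hη : η ∈ weights V) {i : Fin (n + 1)} {w : ℕ} (hw : hub η i = w) {k : ℕ}
    (hk : k ≤ w) : η - (k : ℝ) • simpleRoot i ∈ weights V := by
  rcases Nat.eq_zero_or_pos w with rfl | hpos
  · obtain rfl : k = 0 := by omega
    simpa using hη
  obtain ⟨v, hv, hv0⟩ := (Submodule.ne_bot_iff _).1 hη
  have hhv : ⁅(toAlgebra (.h i) : Algebra n), v⁆ = (w : ℂ) • v := by
    have hw' : η.1 i = w := hw
    rw [(mem_weightSpace.1 hv).1, hw', Complex.ofReal_natCast]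
  -- `IsSl2Triple` requires `h_i ≠ 0`; this holds as `h_i` acts on `v` by the nonzero scalar `w`.
  have h0 : (toAlgebra (.h i) : Algebra n) ≠ 0 := by
    intro h
    rw [h, zero_lie, eq_comm, smul_eq_zero, Nat.cast_eq_zero] at hhv
    exact hhv.elim hpos.ne' hv0
  have t := isSl2Triple h0
  -- `j` is the distance from `η` to the top of the string through `v`.
  obtain ⟨j, hj, hj'⟩ := Nat.exists_not_and_succ_of_not_zero_of_exists
    (p := fun N => (LieModule.toEnd ℂ (Algebra n) V (toAlgebra (.e i)) ^ N) v = 0)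
    (by simpa using hv0) (exists_pow_e_eq_zero hV i v)
  have P : t.HasPrimitiveVectorWith
      ((LieModule.toEnd ℂ (Algebra n) V (toAlgebra (.e i)) ^ j) v) ((w + 2 * j : ℕ) : ℂ) :=
    { ne_zero := hj
      lie_h := by
        rw [t.lie_h_pow_toEnd_e hhv]
        push_cast
        rfl
      lie_e := by
        rwa [pow_succ', Module.End.mul_apply, LieModule.toEnd_apply_apply] at hj' }
  have hne := P.pow_toEnd_f_ne_zero_of_eq_nat rfl (i := j + k) (by omega)
  have hmem := pow_f_mem_weightSpace i (pow_e_mem_weightSpace i hv j) (j + k)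
  have hwt : η + (j : ℝ) • simpleRoot i - ((j + k : ℕ) : ℝ) • simpleRoot i =
      η - (k : ℝ) • simpleRoot i := by
    rw [Nat.cast_add]
    module
  rw [hwt] at hmem
  exact (Submodule.ne_bot_iff _).2 ⟨_, hmem, hne⟩

theorem simpleRoot_ne_zero (i : Fin (n + 1)) : (simpleRoot i : Weight n) ≠ 0 := by
  intro h
  have := congrFun (congrArg Prod.fst h) i
  simp [simpleRoot, cartan_self] at this

/-- Consecutive members of `η, η - α_i, …, η - w α_i` differ by `α_i`, so once all of them are weights
they lie in one connected component. -/
theorem exists_isString {η : Weight n} {i : Fin (n + 1)} {w : ℕ}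
    (h : ∀ k : ℕ, k ≤ w → η - (k : ℝ) • simpleRoot i ∈ weights V) :
    ∃ S : Set (Weight n), IsString V i S ∧ ∀ k : ℕ, k ≤ w → η - (k : ℝ) • simpleRoot i ∈ S := by
  let x : weights (n := n) V := ⟨_, h 0 (Nat.zero_le w)⟩
  refine ⟨_, ⟨(residueGraph V i).connectedComponentMk x, rfl⟩, fun k hk => ⟨⟨_, h k hk⟩, ?_, rfl⟩⟩
  rw [SimpleGraph.ConnectedComponent.mem_supp_iff, SimpleGraph.ConnectedComponent.eq]
  induction k with
  | zero => rfl
  | succ k ih =>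
    refine SimpleGraph.Reachable.trans (SimpleGraph.Adj.reachable ?_) (ih (by omega))
    have hd : (η - (k : ℝ) • simpleRoot i) - (η - ((k + 1 : ℕ) : ℝ) • simpleRoot i) =
        simpleRoot i := by
      rw [Nat.cast_succ]
      module
    refine (SimpleGraph.fromRel_adj _ _ _).2 ⟨fun heq => simpleRoot_ne_zero i ?_, Or.inr hd⟩
    rw [← hd, sub_eq_zero]
    exact (congrArg Subtype.val heq).symm

end Modules

/-! ### Hub and defect along a string -/

theorem hub_sub_smul_simpleRoot (μ : Weight n) (i : Fin (n + 1)) (c : ℝ) :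
    hub (μ - c • simpleRoot i) i = hub μ i - 2 * c := by
  simp [hub, simpleRoot, cartan_self, mul_comm]

theorem level_sub_smul (μ ν : Weight n) (c : ℝ) : level (μ - c • ν) = level μ - c * level ν := by
  simp only [level, hub, Finset.mul_sum, ← Finset.sum_sub_distrib]
  refine Finset.sum_congr rfl fun j _ => ?_
  simp only [Prod.fst_sub, Prod.smul_fst, Pi.sub_apply, Pi.smul_apply, smul_eq_mul]
  ring

theorem form_sub_smul_left (μ ν ρ : Weight n) (c : ℝ) :
    form (μ - c • ν) ρ = form μ ρ - c * form ν ρ := by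
  have h : ∑ i : Fin (n + 1), ∑ j : Fin (n + 1),
      ((min i.val j.val : ℕ) : ℝ) * hub (μ - c • ν) i * hub ρ j =
      (∑ i : Fin (n + 1), ∑ j : Fin (n + 1), ((min i.val j.val : ℕ) : ℝ) * hub μ i * hub ρ j) -
        c * ∑ i : Fin (n + 1), ∑ j : Fin (n + 1),
          ((min i.val j.val : ℕ) : ℝ) * hub ν i * hub ρ j := by
    simp only [Finset.mul_sum, ← Finset.sum_sub_distrib]
    refine Finset.sum_congr rfl fun i _ => Finset.sum_congr rfl fun j _ => ?_
    simp only [hub, Prod.fst_sub, Prod.smul_fst, Pi.sub_apply, Pi.smul_apply, smul_eq_mul]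
    ring
  rw [form, h, level_sub_smul, form, form]
  simp only [Prod.snd_sub, Prod.smul_snd, smul_eq_mul]
  ring

theorem defect_sub_smul_simpleRoot (hn : 1 ≤ n) (Λ μ : Weight n) (i : Fin (n + 1)) (c : ℝ) :
    defect Λ (μ - c • simpleRoot i) =
      defect Λ μ + symmetrizer n i * c * (hub μ i - c) := by
  rw [defect, defect, form_sub_smul_left, form_simpleRoot hn, form_comm μ, form_sub_smul_left,
    form_simpleRoot hn, hub_sub_smul_simpleRoot]
  ring

theorem symmetrizer_pos (i : Fin (n + 1)) : 0 < symmetrizer n i := by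
  unfold symmetrizer
  split_ifs <;> norm_num

theorem hub_dominantWeight (a : Fin (n + 1) → ℕ) (i : Fin (n + 1)) :
    hub (dominantWeight a) i = a i := by
  simp [hub, dominantWeight, fundamentalWeight, Prod.fst_sum, Finset.sum_apply, Pi.single_apply]

theorem exists_int_hub_eq_of_mem_qPlus {α : Weight n} (hα : α ∈ QPlus n) (i : Fin (n + 1)) :
    ∃ z : ℤ, hub α i = z := by
  obtain ⟨c, rfl⟩ := hα
  refine ⟨∑ j, (c j : ℤ) * cartan n i j, ?_⟩
  simp [hub, simpleRoot, Prod.fst_sum, Finset.sum_apply]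

end TwistedAffine

open TwistedAffine in
theorem mainTheorem2 (n : ℕ) (hn : 1 ≤ n) (a : Fin (n + 1) → ℕ)
    (V : Type*) [AddCommGroup V] [Module ℂ V]
    [LieRingModule (TwistedAffine.Algebra n) V] [LieModule ℂ (TwistedAffine.Algebra n) V]
    (hV : IsIrreducibleHighestWeight (n := n) V (dominantWeight a)) (i : Fin (n + 1)) :
    (∀ α ∈ QPlus n, ∀ η : Weight n, η = dominantWeight a - α → η ∈ weights V → 0 ≤ hub η i →
      ∃ w : ℕ, hub η i = w ∧
        -- the weights `η, η - α_i, …, η - w α_i` lie on one `i`-string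
        (∃ S : Set (Weight n), IsString V i S ∧
          ∀ k : ℕ, k ≤ w → η - (k : ℝ) • simpleRoot i ∈ S) ∧
        reflection i η = η - (w : ℝ) • simpleRoot i ∧
        -- defects along the string
        (∀ k : ℕ, k ≤ w →
          defect (dominantWeight a) (η - (k : ℝ) • simpleRoot i) =
            defect (dominantWeight a) η + symmetrizer n i * k * (w - k)) ∧
        -- hub components along the string
        (∀ k : ℕ, k ≤ w → hub (η - (k : ℝ) • simpleRoot i) i = w - 2 * k) ∧
        -- while the defect increases, the absolute value of the hub component decreases
        (∀ k l : ℕ, k < l → 2 * l ≤ w →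
          defect (dominantWeight a) (η - (k : ℝ) • simpleRoot i) <
            defect (dominantWeight a) (η - (l : ℝ) • simpleRoot i) ∧
          |hub (η - (l : ℝ) • simpleRoot i) i| < |hub (η - (k : ℝ) • simpleRoot i) i|) ∧
        -- while the defect decreases, the absolute value of the hub component increases
        (∀ k l : ℕ, w ≤ 2 * k → k < l → l ≤ w →
          defect (dominantWeight a) (η - (l : ℝ) • simpleRoot i) <
            defect (dominantWeight a) (η - (k : ℝ) • simpleRoot i) ∧
          |hub (η - (k : ℝ) • simpleRoot i) i| < |hub (η - (l : ℝ) • simpleRoot i) i|)) ∧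
    (∀ k : ℕ, k ≤ a i →
      dominantWeight a - (k : ℝ) • simpleRoot i ∈ weights V ∧
      defect (dominantWeight a) (dominantWeight a - (k : ℝ) • simpleRoot i) =
        symmetrizer n i * k * (a i - k)) := by
  have hmul : ∀ k l : ℕ, k < l → (k : ℝ) + 1 ≤ l := fun k l h => by exact_mod_cast h
  have hd : 0 < symmetrizer n i := symmetrizer_pos i
  refine ⟨?_, fun k hk => ⟨?_, ?_⟩⟩
  · rintro α hα η hηα hη hpos
    obtain ⟨w, hw⟩ : ∃ w : ℕ, hub η i = w := by
      obtain ⟨z, hz⟩ := exists_int_hub_eq_of_mem_qPlus hα i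
      have hηz : hub η i = ((a i - z : ℤ) : ℝ) := by
        have : hub η i = hub (dominantWeight a) i - hub α i := by rw [hηα]; rfl
        rw [this, hub_dominantWeight, hz]
        push_cast
        rfl
      rw [hηz] at hpos
      obtain ⟨w, hw⟩ := Int.eq_ofNat_of_zero_le (Int.cast_nonneg_iff.1 hpos)
      exact ⟨w, by rw [hηz, hw, Int.cast_natCast]⟩
    refine ⟨w, hw, exists_isString fun k hk => sub_smul_simpleRoot_mem_weights hV hη hw hk,
      by rw [reflection, hw], fun k _ => by rw [defect_sub_smul_simpleRoot hn, hw],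
      fun k _ => by rw [hub_sub_smul_simpleRoot, hw], fun k l hkl hl => ?_,
      fun k l hk hkl _ => ?_⟩
    -- Both cases use `l (w - l) - k (w - k) = (l - k) (w - k - l)`.
    · have h1 := hmul k l hkl
      have h2 : 2 * (l : ℝ) ≤ w := by exact_mod_cast hl
      simp only [defect_sub_smul_simpleRoot hn, hub_sub_smul_simpleRoot, hw]
      refine ⟨?_, ?_⟩
      · have h3 : 0 < symmetrizer n i * (((l : ℝ) - k) * (w - k - l)) :=
          mul_pos hd (mul_pos (by linarith) (by linarith))
        linarith
      · rw [abs_of_nonneg (by linarith), abs_of_nonneg (by linarith)]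
        linarith
    · have h1 := hmul k l hkl
      have h2 : (w : ℝ) ≤ 2 * k := by exact_mod_cast hk
      simp only [defect_sub_smul_simpleRoot hn, hub_sub_smul_simpleRoot, hw]
      refine ⟨?_, ?_⟩
      · have h3 : 0 < symmetrizer n i * (((l : ℝ) - k) * (k + l - w)) :=
          mul_pos hd (mul_pos (by linarith) (by linarith))
        linarith
      · rw [abs_of_nonpos (by linarith), abs_of_nonpos (by linarith)]
        linarith
  · have hΛ : dominantWeight a ∈ weights V := by
      obtain ⟨v, hv0, hv, -⟩ := hV.exists_highest
      exact (Submodule.ne_bot_iff _).2 ⟨v, hv, hv0⟩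
    exact sub_smul_simpleRoot_mem_weights hV hΛ (hub_dominantWeight a i) hk
  · rw [defect_sub_smul_simpleRoot hn, hub_dominantWeight, defect, sub_self, zero_div, zero_add]
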